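/- Let $K$ be a field of prime characteristic $p$ with $[K:K^p]=b<\infty$, let $S=K[\![x_1,\dots,x_n]\!]$ with maximal ideal $\mathfrak m$, let $f\in\mathfrak m$ be nonzero, let $d\ge 0$ be an integer, and let $\Re=S[\![y]\!]/(y^{p^d}+f)$. Notation: for a ring $R$ of characteristic $p$ and $e\ge 0$, $F_*^e(R)$ denotes the $R$-module whose underlying abelian group is $R$, on which $r\in R$ acts as multiplication by $r^{p^e}$; $R$ is $F$-finite if it is Noetherian and $F_*^1(R)$ is a finitely generated $R$-module. For a finitely generated module $M$ over a Noetherian local ring $R$, $\sharp(M,R)$ is the maximal rank of a free direct summand of $M$. For an $F$-finite Noetherian local ring $R$ of characteristic $p$ with residue field $k$, the $F$-signature of $R$ is $$\mathbb S(R)=\lim_{e\to\infty}\frac{\sharp(F_*^e(R),R)}{p^{e(\dim R+\alpha(R))}},\qquad \alpha(R)=\log_p[k:k^p].$$ Then $\Re$ is an $F$-finite Noetherian local ring of characteristic $p$, the limit defining $\mathbb S(\Re)$ exists, and $$\mathbb S(\Re)=\frac{\sharp(F_*^d(\Re),\Re)}{b^d\,p^{nd}}.$$ -/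

import Mathlib

open Filter Topology IsLocalRing

universe u

noncomputable section

/-- The `e`-th Frobenius pushforward `F_*^e(M)`: the additive group `M`, on which `r : R` acts as
multiplication by `r ^ (p ^ e)` (see the `Module` instance below). -/
def FrobPush (_p _e : ℕ) (M : Type u) : Type u := M

instance FrobPush.instAddCommGroup (p e : ℕ) (M : Type u) [AddCommGroup M] :
    AddCommGroup (FrobPush p e M) :=
  inferInstanceAs (AddCommGroup M)

instance FrobPush.instModule (p e : ℕ) (R : Type u) [CommRing R] [ExpChar R p]
    (M : Type u) [AddCommGroup M] [Module R M] : Module R (FrobPush p e M) :=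
  Module.compHom M (iterateFrobenius R p e)

/-- The underlying additive bijection `M ≃ F_*^e(M)`, `m ↦ F_*^e(m)`. -/
def FrobPush.of (p e : ℕ) (M : Type u) [AddCommGroup M] : M ≃+ FrobPush p e M :=
  AddEquiv.refl M

/-- `r • F_*^e(m) = F_*^e(r ^ (p ^ e) • m)`. -/
theorem FrobPush.smul_of (p e : ℕ) {R : Type u} [CommRing R] [ExpChar R p]
    {M : Type u} [AddCommGroup M] [Module R M] (r : R) (m : M) :
    r • FrobPush.of p e M m = FrobPush.of p e M (r ^ (p ^ e) • m) := rfl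

/-- `M` has a direct summand that is free of rank `k`. -/
def HasFreeSummand (R : Type u) [CommRing R] (M : Type u) [AddCommGroup M] [Module R M]
    (k : ℕ) : Prop :=
  ∃ N P : Submodule R M, IsCompl N P ∧ Nonempty (N ≃ₗ[R] (Fin k → R))

/-- `♯(M, R)`: the maximal rank of a free direct summand of the `R`-module `M`
(for `M` finitely generated over a nonzero ring, see `freeRank_isGreatest`). -/
def freeRank (R : Type u) [CommRing R] (M : Type u) [AddCommGroup M] [Module R M] : ℕ :=
  sSup {k : ℕ | HasFreeSummand R M k}

/-- For a finitely generated module over a nonzero ring the maximum exists. -/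
theorem freeRank_isGreatest (R : Type u) [CommRing R] [Nontrivial R]
    (M : Type u) [AddCommGroup M] [Module R M] [Module.Finite R M] :
    IsGreatest {k : ℕ | HasFreeSummand R M k} (freeRank R M) := by
  have hne : {k : ℕ | HasFreeSummand R M k}.Nonempty := by
    refine ⟨0, ⊥, ⊤, isCompl_bot_top, ⟨?_⟩⟩
    exact LinearEquiv.ofSubsingleton _ _
  have hb : BddAbove {k : ℕ | HasFreeSummand R M k} := by
    obtain ⟨m, g, hg⟩ := Module.Finite.exists_fin' R M
    refine ⟨m, ?_⟩
    rintro k ⟨N, P, h, ⟨φ⟩⟩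
    have h1 : Function.Surjective (N.projectionOnto P h) :=
      fun x => ⟨x, Submodule.projectionOnto_apply_left h x⟩
    have h2 : Function.Surjective ((φ.toLinearMap ∘ₗ N.projectionOnto P h) ∘ₗ g) := by
      simpa using (φ.surjective.comp h1).comp hg
    simpa using le_of_fin_surjective R _ h2
  exact ⟨Nat.sSup_mem hne hb, fun k hk => le_csSup hb hk⟩

/-- `[K : K^p]`, the degree of a field `K` of characteristic `p` over its subfield of
`p`-th powers. -/
def pDegree (p : ℕ) (K : Type u) [Field K] [ExpChar K p] : ℕ :=
  Module.finrank (frobenius K p).fieldRange K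

/-- `[K : K^p] < ∞`. -/
def FinitePDegree (p : ℕ) (K : Type u) [Field K] [ExpChar K p] : Prop :=
  Module.Finite (frobenius K p).fieldRange K

/-- A ring of characteristic `p` is `F`-finite if it is Noetherian and `F_*^1(R)` is a finitely
generated `R`-module. -/
def IsFFinite (p : ℕ) (R : Type u) [CommRing R] [ExpChar R p] : Prop :=
  IsNoetherianRing R ∧ Module.Finite R (FrobPush p 1 R)

instance residueField_charP (p : ℕ) [hp : Fact p.Prime] (R : Type u) [CommRing R] [IsLocalRing R]
    [CharP R p] : CharP (ResidueField R) p := by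
  rw [CharP.charP_iff_prime_eq_zero hp.out, ← map_natCast (residue R), CharP.cast_eq_zero,
    map_zero]

/-- The Krull dimension of a nonzero ring of finite dimension, as a natural number. -/
def dimNat (R : Type u) [CommRing R] : ℕ := ((ringKrullDim R).unbotD 0).toNat

/-- `s` is the `F`-signature of the `F`-finite Noetherian local ring `(R, 𝔪, k)` of characteristic
`p`: the sequence `♯(F_*^e(R), R) / p ^ (e (dim R + α(R)))`, where `α(R) = log_p [k : k^p]`,
converges to `s` as `e → ∞`. -/
def HasFSignature (p : ℕ) [Fact p.Prime] (R : Type u) [CommRing R] [IsLocalRing R] [CharP R p]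
    (s : ℝ) : Prop :=
  Tendsto (fun e : ℕ => (freeRank R (FrobPush p e R) : ℝ) /
      (p : ℝ) ^ ((e : ℝ) * ((dimNat R : ℝ) + Real.logb p (pDegree p (ResidueField R)))))
    atTop (𝓝 s)

/-- The ring `S⟦y⟧/(y^(p^d) + f)`, where `S = K⟦x₁, …, xₙ⟧` and `f` lies in the maximal ideal
of `S`. -/
abbrev FrakR {K : Type u} [Field K] {n : ℕ} (p d : ℕ)
    (f : maximalIdeal (MvPowerSeries (Fin n) K)) : Type u :=
  PowerSeries (MvPowerSeries (Fin n) K) ⧸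
    Ideal.span {(PowerSeries.X ^ (p ^ d) + PowerSeries.C (f : MvPowerSeries (Fin n) K) :
      PowerSeries (MvPowerSeries (Fin n) K))}

instance FrakR.instNontrivial {K : Type u} [Field K] {n : ℕ} (p d : ℕ) [hp : Fact p.Prime]
    (f : maximalIdeal (MvPowerSeries (Fin n) K)) : Nontrivial (FrakR p d f) := by
  refine Ideal.Quotient.nontrivial_iff.mpr ?_
  rw [Ne, Ideal.span_singleton_eq_top, PowerSeries.isUnit_iff_constantCoeff]
  have h : p ^ d ≠ 0 := pow_ne_zero _ hp.out.ne_zero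
  rw [map_add, map_pow, PowerSeries.constantCoeff_X, PowerSeries.constantCoeff_C, zero_pow h,
    zero_add]
  exact (mem_maximalIdeal _).mp f.2

instance FrakR.instIsLocalRing {K : Type u} [Field K] {n : ℕ} (p d : ℕ) [Fact p.Prime]
    (f : maximalIdeal (MvPowerSeries (Fin n) K)) : IsLocalRing (FrakR p d f) :=
  IsLocalRing.of_surjective' (Ideal.Quotient.mk _) Ideal.Quotient.mk_surjective

instance FrakR.instCharP {K : Type u} [Field K] {n : ℕ} (p d : ℕ) [hp : Fact p.Prime] [CharP K p]
    (f : maximalIdeal (MvPowerSeries (Fin n) K)) : CharP (FrakR p d f) p := by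
  rw [CharP.charP_iff_prime_eq_zero hp.out]
  have h : ((p : K) : K) = 0 := CharP.cast_eq_zero K p
  rw [← map_natCast (((Ideal.Quotient.mk _).comp PowerSeries.C).comp
    (MvPowerSeries.C : K →+* MvPowerSeries (Fin n) K)) p, h, map_zero]

end

/-! Every `p^d`-th power in ℜ lies in the image of S, because y^(p^d) = -f and Frobenius is
additive. Splitting power series by exponents mod p shows that S is free of rank (b p^n)^e over
itself via the p^e-th power map. As ℜ is free over S by Weierstrass division, this gives a bijection
ℜ ≃ ℜ^m, m = (b p^n)^e, semilinear over S. On F_*^(d+e)(ℜ), r acts through (r^(p^d))^(p^e), so the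
bijection becomes an ℜ-isomorphism F_*^(d+e)(ℜ) ≃ F_*^d(ℜ)^m (`FrobPush.nonempty_linearEquiv_pi`).
Over a local ring the free rank of M^m is m times that of M (`freeRank_pi`). Since dim ℜ = n and the
residue field is K, the normalizing factor is (b p^n)^e, and the sequence is constant from index d
on. -/

/-! ### Free rank over a local ring -/

section FreeRank

variable {R : Type u} [CommRing R] {M : Type u} [AddCommGroup M] [Module R M]

theorem hasFreeSummand_iff_exists_surjective {k : ℕ} :
    HasFreeSummand R M k ↔ ∃ π : M →ₗ[R] (Fin k → R), Function.Surjective π := by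
  constructor
  · rintro ⟨N, P, h, ⟨φ⟩⟩
    refine ⟨φ.toLinearMap ∘ₗ N.projectionOnto P h, ?_⟩
    have h1 : Function.Surjective (N.projectionOnto P h) :=
      fun x => ⟨x, Submodule.projectionOnto_apply_left h x⟩
    simpa using φ.surjective.comp h1
  · rintro ⟨π, hπ⟩
    obtain ⟨i, hi⟩ := Module.projective_lifting_property π LinearMap.id hπ
    have hi' : ∀ v, π (i v) = v := fun v => LinearMap.congr_fun hi v
    refine ⟨LinearMap.range i, LinearMap.ker π, ⟨?_, ?_⟩,
      ⟨(LinearEquiv.ofInjective i (Function.LeftInverse.injective hi')).symm⟩⟩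
    · rw [Submodule.disjoint_def]
      rintro _ ⟨v, rfl⟩ hv
      rw [LinearMap.mem_ker, hi'] at hv
      rw [hv, map_zero]
    · rw [codisjoint_iff, eq_top_iff]
      intro x _
      rw [← add_sub_cancel (i (π x)) x]
      exact Submodule.add_mem_sup ⟨_, rfl⟩ (by simp [hi'])

theorem HasFreeSummand.congr {N : Type u} [AddCommGroup N] [Module R N] (e : M ≃ₗ[R] N) {k : ℕ}
    (h : HasFreeSummand R M k) : HasFreeSummand R N k := by
  rw [hasFreeSummand_iff_exists_surjective] at h ⊢
  obtain ⟨π, hπ⟩ := h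
  exact ⟨π ∘ₗ e.symm.toLinearMap, by simpa using hπ.comp e.symm.surjective⟩

theorem freeRank_congr {N : Type u} [AddCommGroup N] [Module R N] (e : M ≃ₗ[R] N) :
    freeRank R M = freeRank R N := by
  unfold freeRank
  congr 1
  ext k
  exact ⟨fun h => h.congr e, fun h => h.congr e.symm⟩

/-- If the kernel of a split surjection `M → R^ι` has no free summand, then any surjection
`M → R^k` has `k ≤ |ι|`. -/
theorem le_card_of_surjective_of_forall_ker [IsLocalRing R] {ι : Type*} [Fintype ι]
    [DecidableEq ι] (i : (ι → R) →ₗ[R] M)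
    (π : M →ₗ[R] (ι → R)) (hi : ∀ v, π (i v) = v)
    (hker : ∀ (φ : M →ₗ[R] R) (x : M), π x = 0 → φ x ∈ maximalIdeal R)
    {k : ℕ} (ρ : M →ₗ[R] (Fin k → R)) (hρ : Function.Surjective ρ) : k ≤ Fintype.card ι := by
  set A : Matrix (Fin k) ι R := LinearMap.toMatrix' (ρ ∘ₗ i)
  have hA : ∀ u, A.mulVec u = ρ (i u) := fun u => by
    rw [LinearMap.toMatrix'_mulVec]; rfl
  -- Modulo the maximal ideal, `ρ` sees only the free part: `x - i (π x)` lies in the kernel of `π`,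
  -- where functionals take no unit values.
  have hs : Function.Surjective (A.map (residue R)).mulVecLin := by
    intro v
    choose w hw using fun j => residue_surjective (v j)
    obtain ⟨x, hx⟩ := hρ w
    refine ⟨fun j => residue R (π x j), ?_⟩
    ext j
    have h1 : ρ x j - ρ (i (π x)) j ∈ maximalIdeal R := by
      have := hker (LinearMap.proj j ∘ₗ ρ) (x - i (π x)) (by simp [hi])
      simpa using this
    have h2 : residue R (ρ x j) = residue R (ρ (i (π x)) j) := by
      rw [← sub_eq_zero, ← map_sub]
      exact (residue_eq_zero_iff _).mpr h1
    have h3 := RingHom.map_mulVec (residue R) A (π x) j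
    rw [hA, ← h2, hx, hw] at h3
    exact h3.symm
  have := (A.map (residue R)).mulVecLin.finrank_le_finrank_of_surjective hs
  simpa using this

/-- A functional with a unit value on the kernel of `π` could be joined to `π`, giving a free
summand of larger rank. -/
theorem exists_splitting_freeRank [IsLocalRing R] [Module.Finite R M] :
    ∃ (i : (Fin (freeRank R M) → R) →ₗ[R] M) (π : M →ₗ[R] (Fin (freeRank R M) → R)),
      (∀ v, π (i v) = v) ∧
        ∀ (φ : M →ₗ[R] R) (x : M), π x = 0 → φ x ∈ maximalIdeal R := by
  obtain ⟨h, hmax⟩ := freeRank_isGreatest R M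
  obtain ⟨π, hπ⟩ := hasFreeSummand_iff_exists_surjective.mp h
  obtain ⟨i, hi⟩ := Module.projective_lifting_property π LinearMap.id hπ
  have hi' : ∀ v, π (i v) = v := fun v => LinearMap.congr_fun hi v
  refine ⟨i, π, hi', fun φ x hx => ?_⟩
  by_contra hφ
  rw [mem_maximalIdeal, mem_nonunits_iff, not_not] at hφ
  obtain ⟨c, hc⟩ := hφ.exists_left_inv
  have : HasFreeSummand R M (freeRank R M + 1) := by
    refine hasFreeSummand_iff_exists_surjective.mpr
      ⟨LinearMap.pi (Fin.cons φ fun j => LinearMap.proj j ∘ₗ π), fun v => ?_⟩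
    -- Adding a multiple of `x`, which `π` kills, corrects the coordinate `φ` and leaves the others
    -- alone.
    refine ⟨i (Fin.tail v) + ((v 0 - φ (i (Fin.tail v))) * c) • x, ?_⟩
    ext j
    refine Fin.cases ?_ (fun j => ?_) j
    · simp [mul_assoc, hc]
    · simp [hi', hx, Fin.tail]
  exact absurd (hmax this) (by simp)

/-- A functional on M^m is a sum of functionals on the factors, so the m-fold sum of a maximal
splitting again has no unit values on its kernel. -/
theorem freeRank_pi [IsLocalRing R] [Module.Finite R M] (m : ℕ) :
    freeRank R (Fin m → M) = m * freeRank R M := by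
  classical
  obtain ⟨i, π, hi, hker⟩ := exists_splitting_freeRank (R := R) (M := M)
  let c : (Fin m × Fin (freeRank R M) → R) ≃ₗ[R] (Fin m → Fin (freeRank R M) → R) := LinearEquiv.curry R R (Fin m) (Fin (freeRank R M))
  let I : (Fin m × Fin (freeRank R M) → R) →ₗ[R] (Fin m → M) := i.compLeft (Fin m) ∘ₗ c.toLinearMap
  let P : (Fin m → M) →ₗ[R] (Fin m × Fin (freeRank R M) → R) := c.symm.toLinearMap ∘ₗ π.compLeft (Fin m)
  have hI : ∀ v, P (I v) = v := fun v => by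
    have : (π.compLeft (Fin m)) (i.compLeft (Fin m) (c v)) = c v := by
      ext j : 1
      exact hi _
    change c.symm ((π.compLeft (Fin m)) (i.compLeft (Fin m) (c v))) = v
    rw [this, LinearEquiv.symm_apply_apply]
  have hK : ∀ (φ : (Fin m → M) →ₗ[R] R) (x : Fin m → M), P x = 0 → φ x ∈ maximalIdeal R := by
    intro φ x hx
    have hx' : π.compLeft (Fin m) x = 0 := by
      simpa [P] using hx
    rw [← Finset.univ_sum_single x, map_sum]
    exact Ideal.sum_mem _ fun j _ =>
      hker (φ ∘ₗ LinearMap.single R (fun _ => M) j) (x j) (congr_fun hx' j)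
  apply le_antisymm
  · obtain ⟨ρ, hρ⟩ := hasFreeSummand_iff_exists_surjective.mp
      (freeRank_isGreatest R (Fin m → M)).1
    simpa using le_card_of_surjective_of_forall_ker I P hI hK ρ hρ
  · refine (freeRank_isGreatest R (Fin m → M)).2 (hasFreeSummand_iff_exists_surjective.mpr
      ⟨(LinearEquiv.funCongrLeft R R finProdFinEquiv.symm).toLinearMap ∘ₗ P, ?_⟩)
    have : Function.Surjective P := fun v => ⟨I v, hI v⟩
    simpa using (LinearEquiv.funCongrLeft R R finProdFinEquiv.symm).surjective.comp this

end FreeRank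

/-! ### Freeness of K⟦x₁, …, xₙ⟧ over its Frobenius -/

section FrobeniusFree

/-- `A` is free of rank `m` as a module over itself via `a ↦ a ^ q`. -/
def IsPowFree (q : ℕ) (A : Type u) [CommRing A] (m : ℕ) : Prop :=
  ∃ Ψ : A ≃+ (Fin m → A), ∀ s t : A, Ψ (s ^ q * t) = s • Ψ t

theorem IsPowFree.of_fintype {q : ℕ} {A : Type u} [CommRing A] {ι : Type*} [Fintype ι]
    (Ψ : A ≃+ (ι → A)) (h : ∀ s t : A, Ψ (s ^ q * t) = s • Ψ t) :
    IsPowFree q A (Fintype.card ι) := by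
  refine ⟨Ψ.trans (LinearEquiv.funCongrLeft A A (Fintype.equivFin ι).symm).toAddEquiv,
    fun s t => ?_⟩
  ext j
  simp [h, LinearMap.funLeft_apply]

theorem IsPowFree.one (A : Type u) [CommRing A] : IsPowFree 1 A 1 :=
  ⟨(LinearEquiv.funUnique (Fin 1) A A).symm.toAddEquiv, fun s t => by ext; simp⟩

theorem IsPowFree.mul {q q' : ℕ} {A : Type u} [CommRing A] {m m' : ℕ} (h : IsPowFree q A m)
    (h' : IsPowFree q' A m') : IsPowFree (q * q') A (m * m') := by
  obtain ⟨Ψ, hΨ⟩ := h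
  obtain ⟨Φ, hΦ⟩ := h'
  have := IsPowFree.of_fintype (q := q * q') (ι := Fin m' × Fin m)
    ((Φ.trans (AddEquiv.piCongrRight fun _ => Ψ)).trans
      (LinearEquiv.curry A A (Fin m') (Fin m)).symm.toAddEquiv) fun s t => by
    ext ⟨i, j⟩
    have : Φ (s ^ (q * q') * t) = s ^ q • Φ t := by rw [pow_mul, hΦ]
    simp [this, hΨ]
  simpa [mul_comm] using this

theorem IsPowFree.pow {q : ℕ} {A : Type u} [CommRing A] {m : ℕ} (h : IsPowFree q A m) (e : ℕ) :
    IsPowFree (q ^ e) A (m ^ e) := by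
  induction e with
  | zero => simpa using IsPowFree.one A
  | succ e ih => simpa [pow_succ] using ih.mul h

theorem isPowFree_field {K : Type u} [Field K] (p : ℕ) [ExpChar K p] (hK : FinitePDegree p K) :
    IsPowFree p K (pDegree p K) := by
  have : Module.Finite (frobenius K p).fieldRange K := hK
  let B := Module.finBasis (frobenius K p).fieldRange K
  let F : K ≃+* (frobenius K p).fieldRange :=
    RingEquiv.ofBijective (frobenius K p).rangeRestrictField
      ⟨RingHom.injective _, (frobenius K p).rangeRestrictField_bijective.2⟩
  refine ⟨B.equivFun.toAddEquiv.trans (AddEquiv.piCongrRight fun _ => F.symm.toAddEquiv),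
    fun s t => ?_⟩
  have hs : s ^ p * t = F s • t := rfl
  ext j
  change F.symm (B.equivFun (s ^ p * t) j) = s * F.symm (B.equivFun t j)
  rw [hs, map_smul]
  exact (map_mul F.symm _ _).trans (by rw [F.symm_apply_apply])

/-- Division with remainder of exponent vectors by `p`. -/
noncomputable def exponentDivMod (n p : ℕ) [NeZero p] :
    (Fin n →₀ ℕ) ≃ (Fin n → Fin p) × (Fin n →₀ ℕ) where
  toFun u := (fun i => Fin.ofNat p (u i), Finsupp.equivFunOnFinite.symm fun i => u i / p)
  invFun v := p • v.2 + Finsupp.equivFunOnFinite.symm fun i => (v.1 i : ℕ)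
  left_inv u := by
    ext i
    simp [Nat.div_add_mod]
  right_inv v := by
    have hp : 0 < p := Nat.pos_of_ne_zero (NeZero.ne p)
    ext i
    · simp [Nat.mod_eq_of_lt]
    · simp [Nat.mul_add_div hp, Nat.div_eq_of_lt]

open MvPowerSeries in
-- The series `s ^ p` has only exponents divisible by `p`, so multiplying by it preserves the
-- residue class of exponents.
theorem coeff_pow_mul_exponentDivMod_symm {K : Type u} [Field K] (p : ℕ) [Fact p.Prime]
    [ExpChar K p] {n : ℕ}
    (s t : MvPowerSeries (Fin n) K) (a : Fin n → Fin p) (v : Fin n →₀ ℕ) :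
    coeff ((exponentDivMod n p).symm (a, v)) (s ^ p * t) =
      ∑ w ∈ Finset.HasAntidiagonal.antidiagonal v,
        coeff w.1 s ^ p * coeff ((exponentDivMod n p).symm (a, w.2)) t := by
  classical
  have hp : p ≠ 0 := NeZero.ne p
  rw [← map_frobenius_expand p hp, coeff_mul]
  symm
  refine Finset.sum_of_injOn
    (fun w => (p • w.1, (exponentDivMod n p).symm (a, w.2))) ?_ ?_ ?_ ?_
  · rintro ⟨w, w'⟩ - ⟨z, z'⟩ - h
    simp only [Prod.mk.injEq, EmbeddingLike.apply_eq_iff_eq, true_and] at h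
    obtain ⟨h1, rfl⟩ := h
    rw [smul_right_injective (Fin n →₀ ℕ) hp h1]
  · rintro ⟨w, w'⟩ h
    simp only [Finset.mem_coe,
      Finset.HasAntidiagonal.mem_antidiagonal] at h ⊢
    subst h
    simp [exponentDivMod, add_assoc]
  · rintro ⟨u, u'⟩ h hn
    rw [Finset.HasAntidiagonal.mem_antidiagonal] at h
    by_cases hd : ∃ i, ¬ p ∣ u i
    · obtain ⟨i, hi⟩ := hd
      rw [coeff_map, coeff_expand_of_not_dvd p hp s hi, map_zero, zero_mul]
    · exfalso
      push Not at hd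
      choose g hg using hd
      apply hn
      have hu : u = p • Finsupp.equivFunOnFinite.symm g := by
        ext i; simp [hg]
      have hi : ∀ i, p * g i + u' i = p * v i + a i := fun i => by
        have := DFunLike.congr_fun h i
        simpa [hg, exponentDivMod] using this
      -- The remainder satisfies `a i < p`, so p g ≤ p v + a forces g ≤ v.
      have hle : ∀ i, g i ≤ v i := fun i => by
        have h1 : p * g i < p * (v i + 1) := by
          have := hi i; have := (a i).2; rw [mul_add]; omega
        exact Nat.lt_succ_iff.mp (Nat.lt_of_mul_lt_mul_left h1)
      refine ⟨(Finsupp.equivFunOnFinite.symm g,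
        v - Finsupp.equivFunOnFinite.symm g), ?_, ?_⟩
      · simp only [Finset.mem_coe,
          Finset.HasAntidiagonal.mem_antidiagonal]
        ext i; simp [hle i]
      · simp only [Prod.mk.injEq]
        refine ⟨hu.symm, ?_⟩
        ext i
        have h1 := hi i
        have h2 := Nat.mul_le_mul_left p (hle i)
        simp [exponentDivMod, Nat.mul_sub]
        omega
  · rintro ⟨w, w'⟩ -
    simp [coeff_expand_smul, frobenius_def]

/-- Each of the p^n residue classes of exponents gives a series, whose coefficients `Ψ` splits into
`m` components. -/
theorem isPowFree_mvPowerSeries {K : Type u} [Field K] (p : ℕ) [Fact p.Prime] [ExpChar K p]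
    {m : ℕ} (hK : IsPowFree p K m) (n : ℕ) :
    IsPowFree p (MvPowerSeries (Fin n) K) (m * p ^ n) := by
  obtain ⟨Ψ, hΨ⟩ := hK
  let G : MvPowerSeries (Fin n) K ≃+ ((Fin n → Fin p) × Fin m → MvPowerSeries (Fin n) K) :=
    { toFun := fun t x v => Ψ (t ((exponentDivMod n p).symm (x.1, v))) x.2
      invFun := fun g u => Ψ.symm fun j =>
        g (((exponentDivMod n p) u).1, j) ((exponentDivMod n p) u).2
      left_inv := fun t => by
        funext u
        simp
      right_inv := fun g => by
        funext x v
        simp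
      map_add' := fun s t => by
        funext x v
        exact congr_fun (map_add Ψ _ _) x.2 }
  have := IsPowFree.of_fintype (q := p) G fun s t => by
    ext x v
    change Ψ (MvPowerSeries.coeff ((exponentDivMod n p).symm (x.1, v)) (s ^ p * t)) x.2 =
      MvPowerSeries.coeff v (s * G t x)
    rw [coeff_pow_mul_exponentDivMod_symm, MvPowerSeries.coeff_mul, map_sum, Finset.sum_apply]
    refine Finset.sum_congr rfl fun w _ => ?_
    rw [hΨ]
    rfl
  simpa [mul_comm] using this

end FrobeniusFree

/-! ### Dimension, residue field and Weierstrass form of ℜ -/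

section Structure

/-- Needed to see y^(p^d) + f as distinguished at the ideal of the variables. Induction peels off `X
0`. -/
theorem MvPowerSeries.mem_span_range_X {K : Type u} [CommRing K] {n : ℕ}
    (f : MvPowerSeries (Fin n) K) (hf : constantCoeff f = 0) :
    f ∈ Ideal.span (Set.range (X : Fin n → MvPowerSeries (Fin n) K)) := by
  induction n with
  | zero =>
    have : f = 0 := by
      ext u
      rw [Subsingleton.elim u 0, coeff_zero_eq_constantCoeff_apply, hf, map_zero]
    rw [this]
    exact Submodule.zero_mem _
  | succ n ih =>
    set g := finSuccEquiv K n f with hg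
    set a := PowerSeries.constantCoeff g with ha
    have h0 : constantCoeff a = 0 := by
      rw [← hf, ha, hg, ← coeff_zero_eq_constantCoeff_apply,
        ← PowerSeries.coeff_zero_eq_constantCoeff_apply, coeff_coeff_finSuccEquiv,
        ← coeff_zero_eq_constantCoeff_apply]
      congr 1
      simp
    let ψ : MvPowerSeries (Fin n) K →+* MvPowerSeries (Fin (n + 1)) K :=
      ((finSuccEquiv K n).symm : _ →+* _).comp PowerSeries.C
    have h1 : ψ a ∈ Ideal.span (Set.range (X : Fin (n + 1) → MvPowerSeries (Fin (n + 1)) K)) := by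
      have := Ideal.mem_map_of_mem ψ (ih a h0)
      rw [Ideal.map_span] at this
      refine Ideal.span_mono ?_ this
      rintro _ ⟨_, ⟨i, rfl⟩, rfl⟩
      refine ⟨i.succ, ?_⟩
      rw [← (finSuccEquiv K n).symm_apply_apply (X i.succ), finSuccEquiv_X_succ]
      rfl
    have h2 : f = X 0 * (finSuccEquiv K n).symm
        (PowerSeries.mk fun k => PowerSeries.coeff (k + 1) g) + ψ a := by
      apply (finSuccEquiv K n).injective
      rw [map_add, map_mul, finSuccEquiv_X_zero, AlgEquiv.apply_symm_apply]
      change g = _ + finSuccEquiv K n ((finSuccEquiv K n).symm (PowerSeries.C a))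
      rw [AlgEquiv.apply_symm_apply]
      exact PowerSeries.eq_X_mul_shift_add_const g
    rw [h2]
    exact add_mem (Ideal.mul_mem_right _ _ (Ideal.subset_span ⟨0, rfl⟩)) h1

theorem PowerSeries.ringKrullDim_eq_add_one {A : Type u} [CommRing A] [IsDomain A]
    [IsLocalRing A] [IsNoetherianRing A] :
    ringKrullDim (PowerSeries A) = ringKrullDim A + 1 := by
  have hX : (PowerSeries.X : PowerSeries A) ∈ maximalIdeal (PowerSeries A) := by
    rw [mem_maximalIdeal, mem_nonunits_iff, PowerSeries.isUnit_iff_constantCoeff]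
    simp
  rw [← ringKrullDim_quotient_span_singleton_succ_eq_ringKrullDim_of_mem_nonZeroDivisors
    (mem_nonZeroDivisors_of_ne_zero PowerSeries.X_ne_zero) hX]
  have hk : Ideal.span {(PowerSeries.X : PowerSeries A)} =
      RingHom.ker (PowerSeries.constantCoeff (R := A)) := by
    ext g
    rw [Ideal.mem_span_singleton, PowerSeries.X_dvd_iff, RingHom.mem_ker]
  congr 1
  exact ringKrullDim_eq_of_ringEquiv ((Ideal.quotEquivOfEq hk).trans
    (RingHom.quotientKerEquivOfSurjective PowerSeries.constantCoeff_surj))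

theorem MvPowerSeries.ringKrullDim_fin (K : Type u) [Field K] (n : ℕ) :
    ringKrullDim (MvPowerSeries (Fin n) K) = n := by
  induction n with
  | zero =>
    rw [ringKrullDim_eq_of_ringEquiv (isEmptyEquiv (Fin 0) K).toRingEquiv,
      ringKrullDim_eq_zero_of_field]
    rfl
  | succ n ih =>
    have : IsDomain (MvPowerSeries (Fin n) K) := NoZeroDivisors.to_isDomain _
    rw [ringKrullDim_eq_of_ringEquiv (finSuccEquiv K n).toRingEquiv,
      PowerSeries.ringKrullDim_eq_add_one, ih]
    rfl

variable {K : Type u} [Field K] {n : ℕ} (p d : ℕ) [Fact p.Prime]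
  (f : maximalIdeal (MvPowerSeries (Fin n) K))

theorem MvPowerSeries.constantCoeff_eq_zero_of_mem_maximalIdeal :
    constantCoeff (f : MvPowerSeries (Fin n) K) = 0 := by
  by_contra h
  exact (mem_maximalIdeal _).mp f.2 (isUnit_iff_constantCoeff.mpr (isUnit_iff_ne_zero.mpr h))

theorem FrakR.ringKrullDim_eq : ringKrullDim (FrakR p d f) = n := by
  have hq : p ^ d ≠ 0 := pow_ne_zero _ (NeZero.ne p)
  have : IsDomain (MvPowerSeries (Fin n) K) := NoZeroDivisors.to_isDomain _
  have : IsDomain (PowerSeries (MvPowerSeries (Fin n) K)) := NoZeroDivisors.to_isDomain _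
  have hc : PowerSeries.constantCoeff (PowerSeries.X ^ (p ^ d) +
      PowerSeries.C (f : MvPowerSeries (Fin n) K)) = (f : MvPowerSeries (Fin n) K) := by
    rw [map_add, map_pow, PowerSeries.constantCoeff_X, zero_pow hq, zero_add,
      PowerSeries.constantCoeff_C]
  have hm : (PowerSeries.X ^ (p ^ d) + PowerSeries.C (f : MvPowerSeries (Fin n) K)) ∈
      maximalIdeal (PowerSeries (MvPowerSeries (Fin n) K)) := by
    rw [mem_maximalIdeal, mem_nonunits_iff, PowerSeries.isUnit_iff_constantCoeff, hc]
    exact (mem_maximalIdeal _).mp f.2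
  have h0 : (PowerSeries.X ^ (p ^ d) + PowerSeries.C (f : MvPowerSeries (Fin n) K)) ≠ 0 := by
    intro h
    have := congrArg (PowerSeries.coeff (p ^ d)) h
    simp [PowerSeries.coeff_C, NeZero.ne p] at this
  have h := ringKrullDim_quotient_span_singleton_succ_eq_ringKrullDim_of_mem_nonZeroDivisors
    (mem_nonZeroDivisors_of_ne_zero h0) hm
  rw [PowerSeries.ringKrullDim_eq_add_one, MvPowerSeries.ringKrullDim_fin] at h
  exact ENat.WithBot.add_one_cancel.mp h

theorem FrakR.dimNat_eq : dimNat (FrakR p d f) = n := by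
  rw [dimNat, FrakR.ringKrullDim_eq]
  rfl

/-- The residue field of `FrakR p d f` is `K`. -/
theorem FrakR.nonempty_residueField_equiv : Nonempty (ResidueField (FrakR p d f) ≃+* K) := by
  let c : PowerSeries (MvPowerSeries (Fin n) K) →+* K :=
    MvPowerSeries.constantCoeff.comp PowerSeries.constantCoeff
  have hc : Function.Surjective c := fun a => ⟨PowerSeries.C (MvPowerSeries.C a), by simp [c]⟩
  let φ : FrakR p d f →+* K := Ideal.Quotient.lift _ c fun a ha => by
    obtain ⟨g, rfl⟩ := Ideal.mem_span_singleton.mp ha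
    rw [map_mul]
    simp [c, NeZero.ne p, MvPowerSeries.constantCoeff_eq_zero_of_mem_maximalIdeal]
  have hφ : Function.Surjective φ := Ideal.Quotient.lift_surjective_of_surjective _ _ hc
  exact ⟨(Ideal.quotEquivOfEq (ker_eq_maximalIdeal φ hφ).symm).trans
    (RingHom.quotientKerEquivOfSurjective hφ)⟩

theorem pDegree_congr {K L : Type u} [Field K] [Field L] (p : ℕ) [ExpChar K p] [ExpChar L p]
    (e : K ≃+* L) : pDegree p K = pDegree p L := by
  have h : (frobenius K p).fieldRange.map (e : K →+* L) = (frobenius L p).fieldRange := by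
    ext x
    constructor
    · rintro ⟨_, ⟨y, rfl⟩, rfl⟩
      exact ⟨e y, by simp [frobenius_def]⟩
    · rintro ⟨y, rfl⟩
      exact ⟨_, ⟨e.symm y, rfl⟩, by simp [frobenius_def]⟩
  refine Algebra.finrank_eq_of_equiv_equiv
    (RingEquiv.ofBijective ((e : K →+* L).restrict (frobenius K p).fieldRange
      (frobenius L p).fieldRange fun x hx => h ▸ ⟨x, hx, rfl⟩) ⟨RingHom.injective _, ?_⟩) e ?_
  · rintro ⟨x, hx⟩
    rw [← h] at hx
    obtain ⟨y, hy, rfl⟩ := hx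
    exact ⟨⟨y, hy⟩, rfl⟩
  · ext x
    rfl

open Polynomial in
-- By Weierstrass division, a distinguished polynomial has the same quotient in polynomials as in
-- power series.
theorem FrakR.nonempty_algEquiv_adjoinRoot :
    Nonempty (AdjoinRoot (X ^ p ^ d + C (f : MvPowerSeries (Fin n) K))
      ≃ₐ[MvPowerSeries (Fin n) K] FrakR p d f) := by
  have hq : p ^ d ≠ 0 := pow_ne_zero _ (NeZero.ne p)
  set g : (MvPowerSeries (Fin n) K)[X] := X ^ p ^ d + C (f : MvPowerSeries (Fin n) K) with hg
  have hdist : g.IsDistinguishedAt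
      (Ideal.span (Set.range (MvPowerSeries.X : Fin n → MvPowerSeries (Fin n) K))) := by
    refine ⟨⟨fun {k} hk => ?_⟩, monic_X_pow_add_C _ hq⟩
    rw [natDegree_X_pow_add_C] at hk
    rw [hg, coeff_add, coeff_X_pow, if_neg hk.ne, zero_add, coeff_C]
    split_ifs
    · exact MvPowerSeries.mem_span_range_X _
        (MvPowerSeries.constantCoeff_eq_zero_of_mem_maximalIdeal f)
    · exact Submodule.zero_mem _
  have hgc : (g : PowerSeries (MvPowerSeries (Fin n) K)) =
      PowerSeries.X ^ (p ^ d) + PowerSeries.C (f : MvPowerSeries (Fin n) K) := by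
    simp [hg]
  exact ⟨AlgEquiv.trans hdist.algEquivQuotient (Ideal.quotientEquivAlgOfEq _ (by rw [hgc]))⟩

open Polynomial in
/-- `FrakR p d f` is free of rank `p ^ d` over `K⟦x₁, …, xₙ⟧`. -/
theorem FrakR.nonempty_linearEquiv :
    Nonempty (FrakR p d f ≃ₗ[MvPowerSeries (Fin n) K]
      (Fin (p ^ d) → MvPowerSeries (Fin n) K)) := by
  have hq : p ^ d ≠ 0 := pow_ne_zero _ (NeZero.ne p)
  obtain ⟨E⟩ := FrakR.nonempty_algEquiv_adjoinRoot p d f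
  exact ⟨E.symm.toLinearEquiv.trans
    ((AdjoinRoot.powerBasis' (monic_X_pow_add_C _ hq)).basis.equivFun.trans
      (LinearEquiv.funCongrLeft _ _ (finCongr (by simp))))⟩

open Polynomial in
theorem FrakR.exists_pow_eq_algebraMap [ExpChar (FrakR p d f) p] (r : FrakR p d f) :
    ∃ s : MvPowerSeries (Fin n) K, r ^ p ^ d = algebraMap _ (FrakR p d f) s := by
  obtain ⟨E⟩ := FrakR.nonempty_algEquiv_adjoinRoot p d f
  set g : (MvPowerSeries (Fin n) K)[X] := X ^ p ^ d + C (f : MvPowerSeries (Fin n) K) with hg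
  obtain ⟨x, rfl⟩ := E.surjective r
  obtain ⟨t, rfl⟩ := AdjoinRoot.mk_surjective x
  induction t using Polynomial.induction_on' with
  | add a b ha hb =>
    obtain ⟨s, hs⟩ := ha
    obtain ⟨t, ht⟩ := hb
    exact ⟨s + t, by rw [map_add, map_add, map_add, ← hs, ← ht, add_pow_expChar_pow]⟩
  | monomial k a =>
    have hroot : AdjoinRoot.root g ^ p ^ d =
        AdjoinRoot.of g (-(f : MvPowerSeries (Fin n) K)) := by
      rw [map_neg, eq_neg_iff_add_eq_zero, ← AdjoinRoot.mk_X, ← map_pow, ← AdjoinRoot.mk_C,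
        ← map_add]
      exact AdjoinRoot.mk_self
    refine ⟨a ^ p ^ d * (-(f : MvPowerSeries (Fin n) K)) ^ k, ?_⟩
    have hm : AdjoinRoot.mk g (monomial k a) = AdjoinRoot.of g a * AdjoinRoot.root g ^ k := by
      rw [← C_mul_X_pow_eq_monomial, map_mul, map_pow, AdjoinRoot.mk_X, AdjoinRoot.mk_C]
    rw [← map_pow, hm, mul_pow, ← pow_mul, mul_comm k, pow_mul, hroot, ← E.commutes,
      AdjoinRoot.algebraMap_eq, map_mul (AdjoinRoot.of g), map_pow (AdjoinRoot.of g),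
      map_pow (AdjoinRoot.of g)]

end Structure

/-! ### Decomposing Frobenius pushforwards -/

section FrobeniusPushforward

variable {A R : Type u} [CommRing A] [CommRing R] [Algebra A R]

/-- If `R` is free of finite rank over `A` and `A` is free of rank `m` over itself via the `q`-th
power map, then `R ≃ R ^ m`, semilinearly over the `q`-th power map of `A`. -/
theorem IsPowFree.exists_semilinear_addEquiv {q m : ℕ} (h : IsPowFree q A m) {ι : Type*}
    (E : R ≃ₗ[A] (ι → A)) :
    ∃ Θ : R ≃+ (Fin m → R), ∀ (s : A) (x : R), Θ (algebraMap A R s ^ q * x) = s • Θ x := by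
  obtain ⟨Ψ, hΨ⟩ := h
  -- Split each A-coordinate by `Ψ`, swap the two indices, and reassemble each of the `m` slices
  -- into R.
  refine ⟨((E.toAddEquiv.trans (AddEquiv.piCongrRight fun _ => Ψ)).trans
    { Equiv.piComm (fun (_ : ι) (_ : Fin m) => A) with map_add' := fun _ _ => rfl }).trans
      (AddEquiv.piCongrRight fun _ => E.symm.toAddEquiv), fun s x => ?_⟩
  ext j
  change E.symm (fun i => Ψ (E (algebraMap A R s ^ q * x) i) j) =
    s • E.symm (fun i => Ψ (E x i) j)
  rw [← map_smul, ← map_pow, ← Algebra.smul_def, map_smul]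
  congr 1
  ext i
  exact congr_fun (hΨ s (E x i)) j

theorem FrobPush.finite_of_isPowFree (p e : ℕ) [ExpChar R p] {m : ℕ}
    (h : IsPowFree (p ^ e) A m) {ι : Type*} [Finite ι] (E : R ≃ₗ[A] (ι → A)) :
    Module.Finite R (FrobPush p e R) := by
  obtain ⟨Θ, hΘ⟩ := h.exists_semilinear_addEquiv E
  have : Module.Finite A R := Module.Finite.equiv E.symm
  obtain ⟨k, g, hg⟩ := Module.Finite.exists_fin (R := A) (M := Fin m → R)
  classical
  refine ⟨⟨Finset.univ.image fun i => FrobPush.of p e R (Θ.symm (g i)), ?_⟩⟩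
  rw [eq_top_iff]
  intro x _
  obtain ⟨y, rfl⟩ := (FrobPush.of p e R).surjective x
  obtain ⟨c, hc⟩ := Submodule.mem_span_range_iff_exists_fun A |>.mp
    (hg ▸ Submodule.mem_top : Θ y ∈ Submodule.span A (Set.range g))
  have hy : FrobPush.of p e R y =
      ∑ i, algebraMap A R (c i) • FrobPush.of p e R (Θ.symm (g i)) := by
    simp_rw [FrobPush.smul_of, ← map_sum]
    congr 1
    apply Θ.injective
    rw [map_sum, ← hc]
    exact Finset.sum_congr rfl fun i _ => by
      rw [smul_eq_mul, hΘ, AddEquiv.apply_symm_apply]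
  rw [hy]
  exact Submodule.sum_mem _ fun i _ => Submodule.smul_mem _ _ (Submodule.subset_span (by simp))

/-- If all `p ^ d`-th powers of `R` come from `A`, then `F_*^(d + e)(R)` is a direct sum of copies
of `F_*^d(R)`. -/
theorem FrobPush.nonempty_linearEquiv_pi (p d e : ℕ) [ExpChar R p] {m : ℕ}
    (h : IsPowFree (p ^ e) A m) {ι : Type*} (E : R ≃ₗ[A] (ι → A))
    (hd : ∀ r : R, ∃ s : A, r ^ p ^ d = algebraMap A R s) :
    Nonempty (FrobPush p (d + e) R ≃ₗ[R] (Fin m → FrobPush p d R)) := by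
  obtain ⟨Θ, hΘ⟩ := h.exists_semilinear_addEquiv E
  refine ⟨{ ((FrobPush.of p (d + e) R).symm.trans Θ).trans
    (AddEquiv.piCongrRight fun _ => FrobPush.of p d R) with map_smul' := fun r x => ?_ }⟩
  obtain ⟨x, rfl⟩ := (FrobPush.of p (d + e) R).surjective x
  obtain ⟨s, hs⟩ := hd r
  ext j
  change FrobPush.of p d R (Θ (r ^ p ^ (d + e) * x) j) = r • FrobPush.of p d R (Θ x j)
  rw [FrobPush.smul_of, pow_add, pow_mul, hs, hΘ, Pi.smul_apply, Algebra.smul_def, smul_eq_mul]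

end FrobeniusPushforward

theorem mainTheorem12 {K : Type u} [Field K] (p : ℕ) [Fact p.Prime] [CharP K p]
    (b : ℕ) (hK : FinitePDegree p K) (hb : pDegree p K = b)
    (n d : ℕ) (f : IsLocalRing.maximalIdeal (MvPowerSeries (Fin n) K)) (hf : f ≠ 0) :
    IsFFinite p (FrakR p d f) ∧
      HasFSignature p (FrakR p d f)
        ((freeRank (FrakR p d f) (FrobPush p d (FrakR p d f)) : ℝ) /
          ((b : ℝ) ^ d * (p : ℝ) ^ (n * d))) := by
  have hfree : ∀ e, IsPowFree (p ^ e) (MvPowerSeries (Fin n) K) ((b * p ^ n) ^ e) :=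
    (isPowFree_mvPowerSeries p (hb ▸ isPowFree_field p hK) n).pow
  obtain ⟨E⟩ := FrakR.nonempty_linearEquiv p d f
  have hfin : ∀ e, Module.Finite (FrakR p d f) (FrobPush p e (FrakR p d f)) := fun e =>
    FrobPush.finite_of_isPowFree p e (hfree e) E
  refine ⟨⟨inferInstance, hfin 1⟩, ?_⟩
  have hp : (0 : ℝ) < p := Nat.cast_pos.mpr (NeZero.pos p)
  have hp1 : (p : ℝ) ≠ 1 := Nat.cast_ne_one.mpr (Fact.out : p.Prime).ne_one
  have hb0 : (0 : ℝ) < b := by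
    have : Module.Finite (frobenius K p).fieldRange K := hK
    exact Nat.cast_pos.mpr (hb ▸ Module.finrank_pos (R := (frobenius K p).fieldRange) (M := K))
  obtain ⟨ε⟩ := FrakR.nonempty_residueField_equiv p d f
  have hden : ∀ e : ℕ, (p : ℝ) ^ ((e : ℝ) * ((dimNat (FrakR p d f) : ℝ) +
      Real.logb p (pDegree p (ResidueField (FrakR p d f))))) = ((b : ℝ) * p ^ n) ^ e := fun e => by
    rw [FrakR.dimNat_eq, pDegree_congr p ε, hb, mul_comm, Real.rpow_mul hp.le, Real.rpow_add hp,
      Real.rpow_logb hp hp1 hb0, Real.rpow_natCast, Real.rpow_natCast, mul_comm]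
  -- At e = d + k the factor (b p^n)^k cancels, leaving (b p^n)^d below.
  refine tendsto_const_nhds.congr' (eventually_atTop.mpr ⟨d, fun e he => ?_⟩)
  obtain ⟨k, rfl⟩ := Nat.exists_eq_add_of_le he
  obtain ⟨Φ⟩ := FrobPush.nonempty_linearEquiv_pi p d k (hfree k) E
    (FrakR.exists_pow_eq_algebraMap p d f)
  have := hfin d
  beta_reduce
  rw [hden, freeRank_congr Φ, freeRank_pi, pow_mul, ← mul_pow, pow_add]
  have h0 : ((b : ℝ) * p ^ n) ≠ 0 := by positivity
  push_cast
  field_simp
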